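/- Let $H$ be a finite-dimensional real Hilbert space, let $A\colon H\to H$ be firmly nonexpansive, i.e. $\|Ax-Ay\|^2+\|(x-Ax)-(y-Ay)\|^2\le\|x-y\|^2$ for all $x,y\in H$, and let $B\colon H\rightrightarrows H$ be a maximally monotone set-valued operator. Let $J_B=(\mathrm{Id}+B)^{-1}$ be the resolvent of $B$, let $T_{\mathrm{FB}}=J_B\circ(\mathrm{Id}-A)$ be the forward-backward operator, and let $Z=(A+B)^{-1}(0)=\{x\in H : 0\in Ax+Bx\}$. Call two subsets $C,D$ of $H$ nearly equal, written $C\simeq D$, if $\overline{C}=\overline{D}$ and $\operatorname{ri}C=\operatorname{ri}D$, where $\operatorname{ri}C$ is the interior of $C$ relative to its affine hull. Then the following hold. (i) $\operatorname{ran}(\mathrm{Id}-T_{\mathrm{FB}})\simeq\operatorname{ran}A+\operatorname{ran}B$. (ii) If $A$ and $B$ are affine, i.e. their graphs are affine subspaces of $H\times H$, then $\operatorname{ran}(\mathrm{Id}-T_{\mathrm{FB}})=\overline{\operatorname{ran}(\mathrm{Id}-T_{\mathrm{FB}})}=\operatorname{ran}A+\operatorname{ran}B$. If $A$ or $B$ is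 surjective (i.e. $\operatorname{ran}A=H$ or $\operatorname{ran}B=H$), then moreover: (iii) $\operatorname{ran}(\mathrm{Id}-T_{\mathrm{FB}})=H$. (iv) $\operatorname{Fix}T_{\mathrm{FB}}=Z\neq\varnothing$. -/

import Mathlib

open scoped Pointwise

namespace MonotoneOp

variable {H : Type*} [NormedAddCommGroup H] [InnerProductSpace ℝ H]

/-! Set-valued operators `B : H ⇉ H` are modelled as functions `B : H → Set H`. -/

/-- The graph of a set-valued operator. -/
def gra (B : H → Set H) : Set (H × H) := {p | p.2 ∈ B p.1}

/-- The range of a set-valued operator. -/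
def ran (B : H → Set H) : Set H := {u | ∃ x, u ∈ B x}

/-- The inverse of a set-valued operator. -/
def inv (B : H → Set H) : H → Set H := fun u => {x | u ∈ B x}

/-- The fixed points of a set-valued operator. -/
def fix (T : H → Set H) : Set H := {x | x ∈ T x}

/-- A single-valued map, regarded as a set-valued operator. -/
def ofFun (A : H → H) : H → Set H := fun x => {A x}

/-- The operator `Id`. -/
def idOp : H → Set H := ofFun id

/-- A set-valued operator is monotone if `⟪x - y, u - v⟫ ≥ 0` for all `(x, u)`, `(y, v)` in its
graph. -/
def IsMonotone (B : H → Set H) : Prop :=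
  ∀ p ∈ gra B, ∀ q ∈ gra B, 0 ≤ inner ℝ (p.1 - q.1) (p.2 - q.2)

/-- A monotone operator is maximally monotone if its graph is not properly contained in the graph
of another monotone operator. -/
def IsMaximallyMonotone (B : H → Set H) : Prop :=
  IsMonotone B ∧ ∀ C : H → Set H, IsMonotone C → gra B ⊆ gra C → gra C = gra B

/-- `T : H → H` is firmly nonexpansive if
`‖Tx - Ty‖² + ‖(Id - T)x - (Id - T)y‖² ≤ ‖x - y‖²` for all `x`, `y`. -/
def IsFirmlyNonexpansive (T : H → H) : Prop :=
  ∀ x y, ‖T x - T y‖ ^ 2 + ‖(x - T x) - (y - T y)‖ ^ 2 ≤ ‖x - y‖ ^ 2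

/-- An affine relation: the graph is an affine subspace of `H × H`. -/
def IsAffineRelation (B : H → Set H) : Prop :=
  ∃ S : AffineSubspace ℝ (H × H), (S : Set (H × H)) = gra B

/-- The resolvent `J_B = (Id + B)⁻¹`. (The sum of operators is the pointwise Minkowski sum.) -/
def resolventOp (B : H → Set H) : H → Set H := inv (idOp + B)

/-- The forward-backward operator `T_FB = J_B ∘ (Id - A)`. -/
def forwardBackward (A : H → H) (B : H → Set H) : H → Set H :=
  fun x => resolventOp B (x - A x)

/-- The zeros `Z = (A + B)⁻¹(0)` of the sum. -/
def zerosOfSum (A : H → H) (B : H → Set H) : Set H := inv (ofFun A + B) 0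

/-- Near equality of sets: same closure and same relative interior (the interior relative to the
affine hull). -/
def NearlyEqual (C D : Set H) : Prop :=
  closure C = closure D ∧ intrinsicInterior ℝ C = intrinsicInterior ℝ D

end MonotoneOp

/-! Unfolding the resolvent, `w` is a value of `Id - T_FB` iff `w - A x ∈ B (x - w)` for some `x`;
hence the range lies in `E = ran A + ran B`. Everything else follows from
`intrinsicInterior_convexHull_subset_ran`: the range contains `ri (conv E)`. A set between `ri K`
and `K`, with `K` convex, is nearly equal to `K`, which gives (i). In (ii)–(iv) `E` is an affine
subspace, so it equals `ri (conv E)`; the value `w = 0` then yields a zero of `A + B`.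

The inclusion is a Brezis–Haraux argument. Minty's theorem and Banach's fixed point theorem solve
the inclusion with an added term `ε x`. Firm nonexpansiveness gives bounds uniform in `ε`
(`regularized_bound`), so `ε x → 0`, and the part of `x` along the direction of `aff E` stays
bounded. The orthogonal part is invisible to `A` and `B`, so a subsequence of projections converges
to a solution. -/

open Filter Topology

/-! ### Relative interiors of convex sets -/

section RelativeInterior

variable {E : Type*} [NormedAddCommGroup E] [NormedSpace ℝ E]

/-- Metric characterization of the relative interior. -/
theorem mem_intrinsicInterior_iff_dist {s : Set E} {w : E} :
    w ∈ intrinsicInterior ℝ s ↔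
      w ∈ s ∧ ∃ ε > 0, ∀ u ∈ affineSpan ℝ s, dist u w < ε → u ∈ s := by
  rw [mem_intrinsicInterior]
  constructor
  · rintro ⟨y, hy, rfl⟩
    refine ⟨interior_subset (s := ((↑) ⁻¹' s : Set (affineSpan ℝ s))) hy, ?_⟩
    rw [mem_interior_iff_mem_nhds, Metric.mem_nhds_iff] at hy
    obtain ⟨ε, hε, h⟩ := hy
    exact ⟨ε, hε, fun u hu hd => h (show (⟨u, hu⟩ : affineSpan ℝ s) ∈ Metric.ball y ε from hd)⟩
  · rintro ⟨hw, ε, hε, h⟩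
    refine ⟨⟨w, subset_affineSpan ℝ s hw⟩, ?_, rfl⟩
    rw [mem_interior_iff_mem_nhds, Metric.mem_nhds_iff]
    exact ⟨ε, hε, fun u hu => h u u.2 hu⟩

theorem intrinsicInterior_mono_of_affineSpan_eq {s t : Set E} (hst : s ⊆ t)
    (h : affineSpan ℝ s = affineSpan ℝ t) : intrinsicInterior ℝ s ⊆ intrinsicInterior ℝ t := by
  intro w hw
  rw [mem_intrinsicInterior_iff_dist] at hw ⊢
  obtain ⟨hws, ε, hε, H⟩ := hw
  exact ⟨hst hws, ε, hε, fun u hu hd => hst (H u (h ▸ hu) hd)⟩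

theorem intrinsicInterior_affineSubspace (S : AffineSubspace ℝ E) :
    intrinsicInterior ℝ (S : Set E) = S := by
  refine intrinsicInterior_subset.antisymm fun w hw => ?_
  rw [mem_intrinsicInterior_iff_dist]
  exact ⟨hw, 1, one_pos, fun u hu _ => by rwa [AffineSubspace.affineSpan_coe] at hu⟩

/-- The homothety with centre `k` and ratio `1 - t` carries the relative `ε`-ball about `z` to a
relative `(1 - t) * ε`-ball, and convexity keeps it in `s`. -/
theorem Convex.lineMap_mem_intrinsicInterior {s : Set E} (hs : Convex ℝ s) {z k : E}
    (hz : z ∈ intrinsicInterior ℝ s) (hk : k ∈ s) {t : ℝ} (ht0 : 0 ≤ t) (ht1 : t < 1) :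
    AffineMap.lineMap z k t ∈ intrinsicInterior ℝ s := by
  rw [mem_intrinsicInterior_iff_dist] at hz ⊢
  obtain ⟨hzs, ε, hε, H⟩ := hz
  have ht : 0 < 1 - t := sub_pos.2 ht1
  have hy : AffineMap.lineMap z k t ∈ s := hs.lineMap_mem hzs hk ⟨ht0, ht1.le⟩
  refine ⟨hy, (1 - t) * ε, mul_pos ht hε, fun u hu hd => ?_⟩
  set y : E := AffineMap.lineMap z k t with hydef
  have hz' : z + (1 - t)⁻¹ • (u - y) ∈ s := by
    refine H _ ?_ ?_
    · have h1 : u - y ∈ (affineSpan ℝ s).direction :=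
        AffineSubspace.vsub_mem_direction hu (subset_affineSpan ℝ s hy)
      have := AffineSubspace.vadd_mem_of_mem_direction
        ((affineSpan ℝ s).direction.smul_mem (1 - t)⁻¹ h1) (subset_affineSpan ℝ s hzs)
      rwa [vadd_eq_add, add_comm] at this
    · rw [dist_eq_norm] at hd ⊢
      rw [add_sub_cancel_left, norm_smul, Real.norm_of_nonneg (inv_nonneg.2 ht.le),
        inv_mul_lt_iff₀ ht]
      exact hd
  have := hs.lineMap_mem hz' hk ⟨ht0, ht1.le⟩
  convert this using 1
  have e : (1 - t) • (1 - t)⁻¹ • (u - y) = u - y := smul_inv_smul₀ ht.ne' _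
  rw [AffineMap.lineMap_apply_module, smul_add, e, hydef, AffineMap.lineMap_apply_module]
  abel

theorem Convex.subset_closure_intrinsicInterior [FiniteDimensional ℝ E] {s : Set E}
    (hs : Convex ℝ s) : s ⊆ closure (intrinsicInterior ℝ s) := by
  intro k hk
  obtain ⟨z, hz⟩ := Set.Nonempty.intrinsicInterior hs ⟨k, hk⟩
  have hc : Tendsto (fun t : ℝ => AffineMap.lineMap z k t) (𝓝[<] 1) (𝓝 k) := by
    have : Continuous fun t : ℝ => (AffineMap.lineMap z k t : E) := AffineMap.lineMap_continuous
    have h := this.tendsto 1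
    rw [AffineMap.lineMap_apply_one] at h
    exact h.mono_left nhdsWithin_le_nhds
  refine mem_closure_of_tendsto hc ?_
  filter_upwards [Ioo_mem_nhdsLT (zero_lt_one' ℝ)] with t ht
  exact hs.lineMap_mem_intrinsicInterior hz hk ht.1.le ht.2

theorem Convex.affineSpan_intrinsicInterior [FiniteDimensional ℝ E] {s : Set E}
    (hs : Convex ℝ s) : affineSpan ℝ (intrinsicInterior ℝ s) = affineSpan ℝ s := by
  refine (affineSpan_mono ℝ intrinsicInterior_subset).antisymm (affineSpan_le.2 ?_)
  refine hs.subset_closure_intrinsicInterior.trans ?_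
  exact closure_minimal (subset_affineSpan ℝ _) (AffineSubspace.closed_of_finiteDimensional _)

theorem intrinsicInterior_intrinsicInterior {s : Set E}
    (h : affineSpan ℝ (intrinsicInterior ℝ s) = affineSpan ℝ s) :
    intrinsicInterior ℝ (intrinsicInterior ℝ s) = intrinsicInterior ℝ s := by
  refine intrinsicInterior_subset.antisymm fun w hw => ?_
  rw [mem_intrinsicInterior_iff_dist, h]
  refine ⟨hw, ?_⟩
  obtain ⟨-, ε, hε, H⟩ := mem_intrinsicInterior_iff_dist.1 hw
  refine ⟨ε / 2, half_pos hε, fun u hu hd => ?_⟩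
  refine mem_intrinsicInterior_iff_dist.2
    ⟨H u hu (by linarith), ε / 2, half_pos hε, fun v hv hvu => H v hv ?_⟩
  linarith [dist_triangle v u w]

end RelativeInterior

namespace MonotoneOp

variable {H : Type*} [NormedAddCommGroup H] [InnerProductSpace ℝ H]

theorem nearlyEqual_of_intrinsicInterior_subset [FiniteDimensional ℝ H] {C D K : Set H}
    (hK : Convex ℝ K) (hC : intrinsicInterior ℝ K ⊆ C) (hCD : C ⊆ D) (hD : D ⊆ K) :
    NearlyEqual C D := by
  have hKC : K ⊆ closure C := hK.subset_closure_intrinsicInterior.trans (closure_mono hC)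
  have hspan : affineSpan ℝ K ≤ affineSpan ℝ C := by
    rw [← hK.affineSpan_intrinsicInterior]
    exact affineSpan_mono ℝ hC
  have hsC : affineSpan ℝ C = affineSpan ℝ K :=
    (affineSpan_mono ℝ (hCD.trans hD)).antisymm hspan
  have hsD : affineSpan ℝ D = affineSpan ℝ K :=
    (affineSpan_mono ℝ hD).antisymm (hspan.trans (affineSpan_mono ℝ hCD))
  refine ⟨(closure_mono hCD).antisymm (closure_minimal (hD.trans hKC) isClosed_closure), ?_⟩
  refine (intrinsicInterior_mono_of_affineSpan_eq hCD (hsC.trans hsD.symm)).antisymm ?_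
  refine (intrinsicInterior_mono_of_affineSpan_eq hD hsD).trans ?_
  rw [← intrinsicInterior_intrinsicInterior hK.affineSpan_intrinsicInterior]
  exact intrinsicInterior_mono_of_affineSpan_eq hC (hK.affineSpan_intrinsicInterior.trans hsC.symm)

/-! ### Maximal monotonicity and Minty's theorem -/

theorem IsMaximallyMonotone.mem_of_forall {B : H → Set H} (hB : IsMaximallyMonotone B) {x u : H}
    (h : ∀ p ∈ gra B, 0 ≤ inner ℝ (x - p.1) (u - p.2)) : u ∈ B x := by
  let C : H → Set H := fun y => {v | v ∈ B y ∨ (y = x ∧ v = u)}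
  have hC : IsMonotone C := by
    rintro ⟨p, p'⟩ (hp | ⟨rfl, rfl⟩) ⟨q, q'⟩ (hq | ⟨rfl, rfl⟩)
    · exact hB.1 (p, p') hp (q, q') hq
    · have := h (p, p') hp
      rwa [← neg_sub p, ← neg_sub p', inner_neg_neg] at this
    · exact h (q, q') hq
    · simp
  have hmem : (x, u) ∈ gra C := Or.inr ⟨rfl, rfl⟩
  rw [hB.2 C hC fun p hp => Or.inl hp] at hmem
  exact hmem

theorem IsMaximallyMonotone.nonempty_gra {B : H → Set H} (hB : IsMaximallyMonotone B) :
    (gra B).Nonempty := by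
  by_contra h
  rw [Set.not_nonempty_iff_eq_empty] at h
  exact (h ▸ hB.mem_of_forall (x := 0) (u := 0) (by simp [h]) : ((0 : H), (0 : H)) ∈ (∅ : Set _))

theorem IsMaximallyMonotone.mem_of_tendsto {B : H → Set H} (hB : IsMaximallyMonotone B)
    {x u : ℕ → H} {a b : H} (h : ∀ n, u n ∈ B (x n)) (hx : Tendsto x atTop (𝓝 a))
    (hu : Tendsto u atTop (𝓝 b)) : b ∈ B a :=
  hB.mem_of_forall fun p hp =>
    ge_of_tendsto' ((hx.sub_const p.1).inner (hu.sub_const p.2)) fun n => hB.1 (x n, u n) (h n) p hp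

/-- Points of the convex hull of `{(q, c, ⟪q, c⟫)}` lie above the graph of the duality pairing. -/
theorem inner_le_of_mem_convexHull {G : Set (H × H)}
    (hG : ∀ p ∈ G, ∀ q ∈ G, 0 ≤ inner ℝ (p.1 - q.1) (p.2 - q.2)) {z : H × H × ℝ}
    (hz : z ∈ convexHull ℝ ((fun p : H × H => (p.1, p.2, inner ℝ p.1 p.2)) '' G)) :
    inner ℝ z.1 z.2.1 ≤ z.2.2 := by
  have hconv : ∀ y : H × H × ℝ, Convex ℝ {z : H × H × ℝ |
      0 ≤ z.2.2 - inner ℝ z.1 y.2.1 - inner ℝ y.1 z.2.1 + y.2.2} := by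
    intro y a ha b hb s t hs ht hst
    simp only [Set.mem_ofPred_eq, Prod.fst_add, Prod.smul_fst, Prod.snd_add, Prod.smul_snd,
      inner_add_left, inner_add_right, inner_smul_left, inner_smul_right, smul_eq_mul,
      RCLike.conj_to_real] at ha hb ⊢
    have := add_nonneg (mul_nonneg hs ha) (mul_nonneg ht hb)
    have e : y.2.2 = s * y.2.2 + t * y.2.2 := by rw [← add_mul, hst, one_mul]
    rw [e]
    linarith
  -- Monotonicity is affine in each lifted point separately, so it extends to the hull one argument
  -- at a time; the diagonal case is the claim.
  have h1 : ∀ p ∈ G, 0 ≤ z.2.2 - inner ℝ z.1 p.2 - inner ℝ p.1 z.2.1 + inner ℝ p.1 p.2 := by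
    intro p hp
    refine convexHull_min ?_ (hconv (p.1, p.2, inner ℝ p.1 p.2)) hz
    rintro _ ⟨q, hq, rfl⟩
    have := hG q hq p hp
    simp only [inner_sub_left, inner_sub_right] at this
    simp only [Set.mem_ofPred_eq]
    linarith
  have h2 : 0 ≤ z.2.2 - inner ℝ z.1 z.2.1 - inner ℝ z.1 z.2.1 + z.2.2 := by
    refine convexHull_min ?_ (hconv z) hz
    rintro _ ⟨q, hq, rfl⟩
    have := h1 q hq
    simp only [Set.mem_ofPred_eq]
    linarith
  linarith

/-- A minimax argument. Averaging the forms over `p` and minimizing in `y` gives `y = (q - c) / 2`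
and value `-(s + ‖q - c‖² / 4)`, where `(q, c, s)` is the averaged lifted point. Minimizing `s + ‖q
- c‖² / 4` over the compact hull picks the worst average; optimality towards each vertex gives the
inequalities. -/
theorem exists_inner_le_zero_of_finite {G : Set (H × H)} (hfin : G.Finite)
    (hG : ∀ p ∈ G, ∀ q ∈ G, 0 ≤ inner ℝ (p.1 - q.1) (p.2 - q.2)) :
    ∃ y : H, ∀ p ∈ G, inner ℝ (y - p.1) (y + p.2) ≤ 0 := by
  rcases G.eq_empty_or_nonempty with rfl | hne
  · exact ⟨0, by simp⟩
  set S : Set (H × H × ℝ) :=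
    convexHull ℝ ((fun p : H × H => (p.1, p.2, inner ℝ p.1 p.2)) '' G) with hS
  have hScomp : IsCompact S := (hfin.image _).isCompact_convexHull (𝕜 := ℝ)
  have hSne : S.Nonempty := (hne.image _).convexHull
  obtain ⟨z, hz, hmin⟩ := hScomp.exists_isMinOn hSne
    (f := fun z : H × H × ℝ => z.2.2 + ‖z.1 - z.2.1‖ ^ 2 / 4) (by fun_prop)
  set g : H := z.1 - z.2.1 with hg
  refine ⟨(1 / 2 : ℝ) • g, fun p hp => ?_⟩
  have hpS : (p.1, p.2, inner ℝ p.1 p.2) ∈ S := subset_convexHull ℝ _ ⟨p, hp, rfl⟩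
  set d : H := (p.1 - p.2) - g with hd
  set σ : ℝ := inner ℝ p.1 p.2 - z.2.2 with hσ
  have hfirst : ∀ t : ℝ, 0 < t → t ≤ 1 → 0 ≤ σ + inner ℝ g d / 2 + t * (‖d‖ ^ 2 / 4) := by
    intro t ht ht1
    have hmem := (convex_convexHull ℝ _).add_smul_sub_mem hz hpS ⟨ht.le, ht1⟩
    have hle := hmin hmem
    simp only [Set.mem_ofPred_eq, Prod.fst_add, Prod.smul_fst, Prod.fst_sub, Prod.snd_add,
      Prod.smul_snd, Prod.snd_sub, smul_eq_mul] at hle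
    have e : z.1 + t • (p.1 - z.1) - (z.2.1 + t • (p.2 - z.2.1)) = g + t • d := by
      rw [hd, hg]; module
    rw [e, norm_add_sq_real, inner_smul_right, norm_smul, mul_pow, Real.norm_eq_abs, sq_abs,
      ← hσ] at hle
    have : 0 ≤ t * (σ + inner ℝ g d / 2 + t * (‖d‖ ^ 2 / 4)) := by linarith
    exact nonneg_of_mul_nonneg_right this ht
  have hlim : 0 ≤ σ + inner ℝ g d / 2 := by
    have : Tendsto (fun t : ℝ => σ + inner ℝ g d / 2 + t * (‖d‖ ^ 2 / 4)) (𝓝[>] 0)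
        (𝓝 (σ + inner ℝ g d / 2 + 0 * (‖d‖ ^ 2 / 4))) :=
      ((continuous_const.add (continuous_id.mul continuous_const)).tendsto 0).mono_left
        nhdsWithin_le_nhds
    rw [zero_mul, add_zero] at this
    refine ge_of_tendsto this ?_
    filter_upwards [Ioc_mem_nhdsGT (zero_lt_one' ℝ)] with t ht using hfirst t ht.1 ht.2
  -- Monotonicity enters here: `s ≥ ⟪q, c⟫ ≥ -‖q - c‖² / 4` on the hull.
  have hpos : 0 ≤ z.2.2 + ‖g‖ ^ 2 / 4 := by
    have h1 := inner_le_of_mem_convexHull hG hz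
    have h2 : ‖z.1 + z.2.1‖ ^ 2 = ‖g‖ ^ 2 + 4 * inner ℝ z.1 z.2.1 := by
      rw [hg, norm_add_sq_real, norm_sub_sq_real]; ring
    have := sq_nonneg ‖z.1 + z.2.1‖
    linarith
  have e1 : inner ℝ g d = inner ℝ g p.1 - inner ℝ g p.2 - ‖g‖ ^ 2 := by
    rw [hd, inner_sub_right, inner_sub_right, real_inner_self_eq_norm_sq]
  simp only [inner_sub_left, inner_add_right, inner_smul_left, inner_smul_right,
    RCLike.conj_to_real, real_inner_self_eq_norm_sq, real_inner_comm g p.1]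
  linarith

/-- **Minty's theorem**: `Id + B` is surjective for maximally monotone `B`. -/
theorem IsMaximallyMonotone.exists_sub_mem [FiniteDimensional ℝ H] {B : H → Set H}
    (hB : IsMaximallyMonotone B) (z : H) : ∃ y, z - y ∈ B y := by
  obtain ⟨p₀, hp₀⟩ := hB.nonempty_gra
  -- `y ∈ K p` says that `(y, z - y)` is monotonically related to `p`. Maximality thus asks for a
  -- point common to all `K p`, supplied by the finite intersection property in the compact set `K
  -- p₀`.
  let K : H × H → Set H := fun p => {y | inner ℝ (y - p.1) (y + (p.2 - z)) ≤ 0}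
  have hclosed : ∀ p, IsClosed (K p) := fun p => isClosed_le (by fun_prop) continuous_const
  have hbdd : Bornology.IsBounded (K p₀) := by
    rw [isBounded_iff_forall_norm_le]
    refine ⟨2 * (‖p₀.1‖ + ‖p₀.2 - z‖), fun y hy => ?_⟩
    have hy' : inner ℝ (y - p₀.1) (y + (p₀.2 - z)) ≤ 0 := hy
    rw [inner_sub_left, inner_add_right, inner_add_right, real_inner_self_eq_norm_sq] at hy'
    have h1 := abs_le.1 (abs_real_inner_le_norm y (p₀.2 - z))
    have h2 := abs_le.1 (abs_real_inner_le_norm p₀.1 y)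
    have h3 := abs_le.1 (abs_real_inner_le_norm p₀.1 (p₀.2 - z))
    by_contra! hlt
    nlinarith [norm_nonneg p₀.1, norm_nonneg (p₀.2 - z), norm_nonneg y]
  have hcomp : IsCompact (K p₀) := Metric.isCompact_of_isClosed_isBounded (hclosed p₀) hbdd
  obtain ⟨y, -, hy⟩ := hcomp.inter_iInter_nonempty (fun p : gra B => K p) (fun p => hclosed p) (by
    intro t
    let G : Set (H × H) :=
      (fun p : H × H => (p.1, p.2 - z)) '' (insert p₀ ((↑) '' (t : Set (gra B))))
    obtain ⟨y, hy⟩ := exists_inner_le_zero_of_finite (G := G)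
      (((t.finite_toSet.image _).insert _).image _) (by
        have hsub : insert p₀ ((↑) '' (t : Set (gra B))) ⊆ gra B := by
          rintro _ (rfl | ⟨p, -, rfl⟩)
          exacts [hp₀, p.2]
        rintro _ ⟨p, hp, rfl⟩ _ ⟨q, hq, rfl⟩
        have := hB.1 p (hsub hp) q (hsub hq)
        simpa using this)
    refine ⟨y, hy _ ⟨p₀, Or.inl rfl, rfl⟩, Set.mem_iInter₂.2 fun p hp => ?_⟩
    exact hy _ ⟨p, Or.inr ⟨p, hp, rfl⟩, rfl⟩)
  refine ⟨y, hB.mem_of_forall fun p hp => ?_⟩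
  have := Set.mem_iInter.1 hy ⟨p, hp⟩
  have this' : inner ℝ (y - p.1) (y + (p.2 - z)) ≤ 0 := this
  have e : z - y - p.2 = -(y + (p.2 - z)) := by abel
  rw [e, inner_neg_right]
  linarith

end MonotoneOp

/-! ### Regularization and uniform estimates -/

namespace MonotoneOp

variable {H : Type*} [NormedAddCommGroup H] [InnerProductSpace ℝ H]

theorem IsFirmlyNonexpansive.norm_sq_le_inner {A : H → H} (hA : IsFirmlyNonexpansive A) (x y : H) :
    ‖A x - A y‖ ^ 2 ≤ inner ℝ (x - y) (A x - A y) := by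
  have h := hA x y
  have e : (x - A x) - (y - A y) = (x - y) - (A x - A y) := by abel
  rw [e, norm_sub_sq_real (x - y)] at h
  linarith

theorem IsFirmlyNonexpansive.norm_le {A : H → H} (hA : IsFirmlyNonexpansive A) (x y : H) :
    ‖A x - A y‖ ≤ ‖x - y‖ := by
  have h := hA x y
  exact le_of_sq_le_sq (by nlinarith [sq_nonneg ‖(x - A x) - (y - A y)‖]) (norm_nonneg _)

theorem IsFirmlyNonexpansive.continuous {A : H → H} (hA : IsFirmlyNonexpansive A) :
    Continuous A :=
  (LipschitzWith.of_dist_le_mul (K := 1) fun x y => by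
    simpa [dist_eq_norm] using hA.norm_le x y).continuous

/-- In the expanded square the cross term is at most `-2 (1 - ε) ‖A x - A y‖²`, which absorbs `‖A x
- A y‖²` because `ε ≤ 1 / 2`. -/
theorem IsFirmlyNonexpansive.norm_smul_sub_le {A : H → H} (hA : IsFirmlyNonexpansive A)
    {ε : ℝ} (hε' : ε ≤ 1 / 2) (x y : H) :
    ‖((1 - ε) • x - A x) - ((1 - ε) • y - A y)‖ ≤ (1 - ε) * ‖x - y‖ := by
  have h := hA.norm_sq_le_inner x y
  have e : ((1 - ε) • x - A x) - ((1 - ε) • y - A y) = (1 - ε) • (x - y) - (A x - A y) := by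
    module
  refine le_of_sq_le_sq ?_ (mul_nonneg (by linarith) (norm_nonneg _))
  rw [e, norm_sub_sq_real, inner_smul_left, norm_smul, RCLike.conj_to_real,
    Real.norm_of_nonneg (by linarith : 0 ≤ 1 - ε)]
  nlinarith [sq_nonneg ‖A x - A y‖]

/-- The Tikhonov-regularized inclusion `w ∈ ε x + A x + B (x - w)` is solvable. -/
theorem exists_regularized_solution [FiniteDimensional ℝ H] {A : H → H} {B : H → Set H}
    (hA : IsFirmlyNonexpansive A) (hB : IsMaximallyMonotone B) (w : H) {ε : ℝ} (hε : 0 < ε)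
    (hε' : ε ≤ 1 / 2) : ∃ x, w - ε • x - A x ∈ B (x - w) := by
  choose J hJ using hB.exists_sub_mem
  have hJn : ∀ z z', ‖J z - J z'‖ ≤ ‖z - z'‖ := by
    intro z z'
    have h := hB.1 (J z, z - J z) (hJ z) (J z', z' - J z') (hJ z')
    have e : (z - J z) - (z' - J z') = (z - z') - (J z - J z') := by abel
    simp only [e, inner_sub_right _ (z - z'), real_inner_self_eq_norm_sq] at h
    have h2 := real_inner_le_norm (J z - J z') (z - z')
    by_contra! hlt
    nlinarith [norm_nonneg (z - z')]
  have hf : ContractingWith (1 - ε).toNNReal fun x => w + J ((1 - ε) • x - A x) := by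
    refine ⟨by rw [Real.toNNReal_lt_one]; linarith, LipschitzWith.of_dist_le_mul fun x y => ?_⟩
    rw [Real.coe_toNNReal _ (by linarith), dist_eq_norm, dist_eq_norm, add_sub_add_left_eq_sub]
    exact (hJn _ _).trans (hA.norm_smul_sub_le hε' x y)
  refine ⟨hf.fixedPoint, ?_⟩
  have hfix : w + J ((1 - ε) • hf.fixedPoint - A hf.fixedPoint) = hf.fixedPoint :=
    hf.fixedPoint_isFixedPt
  generalize hf.fixedPoint = x at hfix
  have h := hJ ((1 - ε) • x - A x)
  have e : J ((1 - ε) • x - A x) = x - w := eq_sub_of_add_eq' hfix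
  rw [e] at h
  convert h using 1
  module

/-- The point is that `c` depends neither on `ε` nor on the solution. For `v ∈ ran A + ran B` it
comes from monotonicity of `B`; the estimate is affine in `v`, so it passes to convex combinations.
-/
theorem regularized_bound {A : H → H} {B : H → Set H}
    (hA : IsFirmlyNonexpansive A) (hB : IsMonotone B) (w : H) {v : H}
    (hv : v ∈ convexHull ℝ (Set.range A + ran B)) :
    ∃ c : ℝ, ∀ ε : ℝ, 0 < ε → ε ≤ 1 / 2 → ∀ x, w - ε • x - A x ∈ B (x - w) →
      inner ℝ x (v - w) + ε * ‖x‖ ^ 2 / 2 ≤ c := by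
  refine convexHull_min (t := {v | ∃ c : ℝ, ∀ ε : ℝ, 0 < ε → ε ≤ 1 / 2 → ∀ x,
    w - ε • x - A x ∈ B (x - w) → inner ℝ x (v - w) + ε * ‖x‖ ^ 2 / 2 ≤ c}) ?_ ?_ hv
  · rintro _ ⟨_, ⟨p, rfl⟩, b, ⟨q, hq⟩, rfl⟩
    set r : H := w + q with hr
    refine ⟨inner ℝ r (A p + b - w) + ‖p - r‖ ^ 2 / 4 + ‖r‖ ^ 2, fun ε hε hε' x hx => ?_⟩
    have h1 := hB (x - w, w - ε • x - A x) hx (q, b) hq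
    have e1 : x - w - q = x - r := by rw [hr]; abel
    have e2 : w - ε • x - A x - b = -(A p + b - w) - ε • x - (A x - A p) := by abel
    simp only [e1, e2, inner_sub_right (x - r) (-(A p + b - w) - ε • x),
      inner_sub_right (x - r) (-(A p + b - w)), inner_neg_right, inner_smul_right] at h1
    -- Bounded below uniformly in `x` although `p` and `r` are unrelated: completing the square uses
    -- the term `‖A x - A p‖²` that mere monotonicity would not give.
    have h2 : -(‖p - r‖ ^ 2 / 4) ≤ inner ℝ (x - r) (A x - A p) := by
      have h3 := hA.norm_sq_le_inner x p
      have e3 : x - r = (x - p) + (p - r) := by abel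
      rw [e3, inner_add_left]
      have h4 := abs_le.1 (abs_real_inner_le_norm (p - r) (A x - A p))
      nlinarith [sq_nonneg (‖A x - A p‖ - ‖p - r‖ / 2)]
    have h5 : inner ℝ (x - r) x = ‖x‖ ^ 2 - inner ℝ r x := by
      rw [inner_sub_left, real_inner_self_eq_norm_sq]
    have h6 : ‖x‖ ^ 2 / 2 - ‖r‖ ^ 2 / 2 ≤ inner ℝ (x - r) x := by
      rw [h5]
      nlinarith [real_inner_le_norm r x, sq_nonneg (‖x‖ - ‖r‖)]
    have h7 := mul_le_mul_of_nonneg_left h6 hε.le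
    have h8 : ε * ‖r‖ ^ 2 ≤ 1 * ‖r‖ ^ 2 := by gcongr; linarith
    rw [inner_sub_left x r (A p + b - w)] at h1
    show inner ℝ x (A p + b - w) + _ ≤ _
    linarith [sq_nonneg ‖r‖]
  · rintro a ⟨c, hc⟩ b ⟨c', hc'⟩ s t hs ht hst
    refine ⟨s * c + t * c', fun ε hε hε' x hx => ?_⟩
    have h1 := mul_le_mul_of_nonneg_left (hc ε hε hε' x hx) hs
    have h2 := mul_le_mul_of_nonneg_left (hc' ε hε hε' x hx) ht
    obtain rfl : s = 1 - t := by linarith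
    simp only [inner_sub_right, inner_add_right, inner_smul_right] at h1 h2 ⊢
    linarith

theorem IsFirmlyNonexpansive.map_add_of_inner_eq_zero {A : H → H} (hA : IsFirmlyNonexpansive A)
    {x n : H} (h : inner ℝ n (A (x + n) - A x) = 0) : A (x + n) = A x := by
  have h1 := hA.norm_sq_le_inner (x + n) x
  rw [add_sub_cancel_left, h] at h1
  exact sub_eq_zero.1 (norm_eq_zero.1 (pow_eq_zero_iff two_ne_zero |>.1
    (le_antisymm h1 (sq_nonneg _))))

theorem IsMaximallyMonotone.mem_add_of_forall_inner_eq_zero {B : H → Set H}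
    (hB : IsMaximallyMonotone B) {y b n : H} (hb : b ∈ B y)
    (h : ∀ c ∈ ran B, inner ℝ n (b - c) = 0) : b ∈ B (y + n) := by
  refine hB.mem_of_forall fun p hp => ?_
  rw [add_sub_right_comm, inner_add_left, h p.2 ⟨p.1, hp⟩, add_zero]
  exact hB.1 (y, b) hb p hp

theorem mem_ran_id_sub_forwardBackward {A : H → H} {B : H → Set H} {w : H} :
    w ∈ ran (idOp - forwardBackward A B) ↔ ∃ x, w - A x ∈ B (x - w) := by
  have key : ∀ x y : H, y ∈ forwardBackward A B x ↔ x - A x - y ∈ B y := by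
    intro x y
    simp only [forwardBackward, resolventOp, inv, idOp, ofFun, Set.mem_ofPred_eq, Pi.add_apply,
      Set.singleton_add, Set.mem_image, id]
    exact ⟨by rintro ⟨u, hu, h⟩; rwa [← h, add_sub_cancel_left], fun h => ⟨_, h, by abel⟩⟩
  constructor
  · rintro ⟨x, x', hx', y, hy, rfl⟩
    obtain rfl : x' = x := hx'
    refine ⟨x', ?_⟩
    rw [key] at hy
    simp only
    rwa [sub_sub_cancel, sub_right_comm]
  · rintro ⟨x, hx⟩
    refine ⟨x, x, rfl, x - w, (key _ _).2 ?_, by simp⟩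
    convert hx using 1
    abel

/-- The relative interior of the convex hull of `ran A + ran B` consists of values of
`Id - T_FB`. -/
theorem intrinsicInterior_convexHull_subset_ran [FiniteDimensional ℝ H] {A : H → H}
    {B : H → Set H} (hA : IsFirmlyNonexpansive A) (hB : IsMaximallyMonotone B) :
    intrinsicInterior ℝ (convexHull ℝ (Set.range A + ran B)) ⊆
      ran (idOp - forwardBackward A B) := by
  intro w hw
  rw [mem_intrinsicInterior_iff_dist, affineSpan_convexHull] at hw
  obtain ⟨hwK, δ, hδ, hball⟩ := hw
  rw [mem_ran_id_sub_forwardBackward]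
  set E : Set H := Set.range A + ran B with hE
  set V : Submodule ℝ H := (affineSpan ℝ E).direction with hV
  obtain ⟨p₀, hp₀⟩ := hB.nonempty_gra
  have hAV : ∀ x y, A x - A y ∈ V := by
    intro x y
    have := AffineSubspace.vsub_mem_direction
      (subset_affineSpan ℝ E (Set.add_mem_add (Set.mem_range_self x) ⟨p₀.1, hp₀⟩))
      (subset_affineSpan ℝ E (Set.add_mem_add (Set.mem_range_self y) ⟨p₀.1, hp₀⟩))
    rwa [vsub_eq_sub, add_sub_add_right_eq_sub] at this
  have hBV : ∀ b ∈ ran B, ∀ c ∈ ran B, b - c ∈ V := by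
    intro b hb c hc
    have := AffineSubspace.vsub_mem_direction
      (subset_affineSpan ℝ E (Set.add_mem_add (Set.mem_range_self 0) hb))
      (subset_affineSpan ℝ E (Set.add_mem_add (Set.mem_range_self 0) hc))
    rwa [vsub_eq_sub, add_sub_add_left_eq_sub] at this
  let ε : ℕ → ℝ := fun n => 1 / ((n : ℝ) + 2)
  have hε0 : ∀ n, 0 < ε n := fun n => by positivity
  have hε1 : ∀ n, ε n ≤ 1 / 2 := fun n =>
    one_div_le_one_div_of_le two_pos (by linarith [n.cast_nonneg (α := ℝ)])
  have hεlim : Tendsto ε atTop (𝓝 0) := by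
    have := (tendsto_one_div_add_atTop_nhds_zero_nat (𝕜 := ℝ)).comp (tendsto_add_atTop_nat 1)
    refine this.congr fun n => ?_
    simp only [Function.comp_apply, ε]
    push_cast
    ring_nf
  choose x hx using fun n => exists_regularized_solution hA hB w (hε0 n) (hε1 n)
  -- Taking `v = w` kills the linear term, leaving `‖ε x‖² ≤ 2 c ε`.
  have hεx : Tendsto (fun n => ε n • x n) atTop (𝓝 0) := by
    obtain ⟨c, hc⟩ := regularized_bound hA hB.1 w hwK
    rw [tendsto_zero_iff_norm_tendsto_zero]
    have hsq : Tendsto (fun n => Real.sqrt (2 * c * ε n)) atTop (𝓝 0) := by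
      have := (hεlim.const_mul (2 * c)).sqrt
      rwa [mul_zero, Real.sqrt_zero] at this
    refine squeeze_zero (fun n => norm_nonneg _) (fun n => ?_) hsq
    refine Real.le_sqrt_of_sq_le ?_
    have h := hc (ε n) (hε0 n) (hε1 n) (x n) (hx n)
    rw [sub_self, inner_zero_right, zero_add] at h
    rw [norm_smul, mul_pow, Real.norm_of_nonneg (hε0 n).le]
    have := mul_le_mul_of_nonneg_left h (hε0 n).le
    nlinarith
  -- The estimates do not control `x n` orthogonally to `V`, so only the projection is kept.
  let p : ℕ → V := fun n => V.orthogonalProjectionOnto (x n)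
  have hperp : ∀ n, ∀ v ∈ V, inner ℝ ((p n : H) - x n) v = 0 := by
    intro n v hv
    have h := V.starProjection_inner_eq_zero (x n) v hv
    rw [← neg_sub, inner_neg_left]
    exact neg_eq_zero.2 h
  -- Since `w` is relatively interior, `v = w + t • d` is admissible for small `t > 0`; using `d`
  -- and `-d` gives the pointwise bounds for Banach–Steinhaus.
  have hbdd_above : ∀ d : V, ∃ c, ∀ n, inner ℝ (p n : H) (d : H) ≤ c := by
    intro d
    obtain ⟨t, ht, htd⟩ : ∃ t : ℝ, 0 < t ∧ t * ‖(d : H)‖ < δ := by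
      refine ⟨δ / (‖(d : H)‖ + 1), by positivity, ?_⟩
      rw [div_mul_eq_mul_div, div_lt_iff₀ (by positivity)]
      nlinarith
    have hmem : w + t • (d : H) ∈ convexHull ℝ E := by
      refine hball _ ?_ ?_
      · have := AffineSubspace.vadd_mem_of_mem_direction (V.smul_mem t d.2)
          (convexHull_subset_affineSpan E hwK)
        rwa [vadd_eq_add, add_comm] at this
      · rwa [dist_eq_norm, add_sub_cancel_left, norm_smul, Real.norm_of_nonneg ht.le]
    obtain ⟨c, hc⟩ := regularized_bound hA hB.1 w hmem
    refine ⟨c / t, fun n => ?_⟩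
    have h := hc (ε n) (hε0 n) (hε1 n) (x n) (hx n)
    rw [add_sub_cancel_left, inner_smul_right] at h
    have h2 := hperp n d d.2
    rw [inner_sub_left, sub_eq_zero] at h2
    rw [h2, le_div_iff₀ ht]
    have : 0 ≤ ε n * ‖x n‖ ^ 2 / 2 := by have := (hε0 n).le; positivity
    linarith
  obtain ⟨M, hM⟩ : ∃ M, ∀ n, ‖innerSL ℝ (p n)‖ ≤ M := by
    refine banach_steinhaus fun d => ?_
    obtain ⟨c, hc⟩ := hbdd_above d
    obtain ⟨c', hc'⟩ := hbdd_above (-d)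
    refine ⟨max c c', fun n => ?_⟩
    have h := hc' n
    rw [Submodule.coe_neg, inner_neg_right] at h
    rw [innerSL_apply_apply, Submodule.coe_inner, Real.norm_eq_abs, abs_le]
    exact ⟨by linarith [le_max_right c c'], (hc n).trans (le_max_left _ _)⟩
  have hpM : ∀ n, (p n : H) ∈ Metric.closedBall (0 : H) M := by
    intro n
    rw [mem_closedBall_zero_iff]
    have := hM n
    rwa [innerSL_apply_norm] at this
  obtain ⟨a, -, φ, hφ, ha⟩ := tendsto_subseq_of_bounded Metric.isBounded_closedBall hpM
  have hp : ∀ n, w - ε n • x n - A (p n) ∈ B ((p n : H) - w) := by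
    intro n
    have e : (p n : H) = x n + ((p n : H) - x n) := by abel
    have h1 : A (p n) = A (x n) := by
      rw [e]
      exact hA.map_add_of_inner_eq_zero (hperp n _ (hAV _ _))
    have h2 := hB.mem_add_of_forall_inner_eq_zero (n := (p n : H) - x n) (hx n)
      fun c hc => hperp n _ (hBV _ ⟨_, hx n⟩ c hc)
    rw [h1]
    convert h2 using 2
    abel
  refine ⟨a, hB.mem_of_tendsto (fun n => hp (φ n)) (ha.sub_const w) ?_⟩
  have h1 := (tendsto_const_nhds (x := w)).sub (hεx.comp hφ.tendsto_atTop)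
  rw [sub_zero] at h1
  exact h1.sub ((hA.continuous.tendsto a).comp ha)

/-! ### Range inclusion, affine relations, zeros and fixed points -/

theorem ran_id_sub_forwardBackward_subset (A : H → H) (B : H → Set H) :
    ran (idOp - forwardBackward A B) ⊆ Set.range A + ran B := by
  intro w hw
  obtain ⟨x, hx⟩ := mem_ran_id_sub_forwardBackward.1 hw
  exact ⟨A x, ⟨x, rfl⟩, w - A x, ⟨_, hx⟩, add_sub_cancel _ _⟩

theorem IsAffineRelation.exists_affineSubspace_ran {B : H → Set H} (hB : IsAffineRelation B) :
    ∃ S : AffineSubspace ℝ H, (S : Set H) = ran B := by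
  obtain ⟨S, hS⟩ := hB
  refine ⟨S.map (LinearMap.snd ℝ H H).toAffineMap, ?_⟩
  rw [AffineSubspace.coe_map, hS]
  ext u
  exact ⟨by rintro ⟨q, hq, rfl⟩; exact ⟨q.1, hq⟩, by rintro ⟨x, hx⟩; exact ⟨(x, u), hx, rfl⟩⟩

theorem exists_affineSubspace_add (S T : AffineSubspace ℝ H) :
    ∃ U : AffineSubspace ℝ H, (U : Set H) = (S : Set H) + (T : Set H) := by
  refine ⟨(S.prod T).map
    (LinearMap.fst ℝ H H + LinearMap.snd ℝ H H).toAffineMap, ?_⟩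
  ext u
  constructor
  · rintro ⟨q, hq, rfl⟩
    exact ⟨q.1, hq.1, q.2, hq.2, rfl⟩
  · rintro ⟨a, ha, b, hb, rfl⟩
    exact ⟨(a, b), ⟨ha, hb⟩, rfl⟩

theorem ran_ofFun (A : H → H) : ran (ofFun A) = Set.range A := by
  ext u
  exact ⟨fun ⟨x, hx⟩ => ⟨x, hx.symm⟩, fun ⟨x, hx⟩ => ⟨x, hx.symm⟩⟩

theorem mem_zerosOfSum {A : H → H} {B : H → Set H} {x : H} :
    x ∈ zerosOfSum A B ↔ -A x ∈ B x := by
  simp only [zerosOfSum, inv, ofFun, Set.mem_ofPred_eq, Pi.add_apply, Set.singleton_add,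
    Set.mem_image]
  exact ⟨by rintro ⟨u, hu, h⟩; rwa [neg_eq_of_add_eq_zero_right h],
    fun h => ⟨_, h, add_neg_cancel _⟩⟩

theorem fix_forwardBackward (A : H → H) (B : H → Set H) :
    fix (forwardBackward A B) = zerosOfSum A B := by
  ext x
  rw [mem_zerosOfSum]
  simp only [fix, forwardBackward, resolventOp, inv, idOp, ofFun, Set.mem_ofPred_eq, Pi.add_apply,
    Set.singleton_add, Set.mem_image, id, sub_eq_add_neg, add_right_inj, exists_eq_right]

end MonotoneOp

theorem mainTheorem2 {H : Type*} [NormedAddCommGroup H] [InnerProductSpace ℝ H]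
    [FiniteDimensional ℝ H] (A : H → H) (B : H → Set H)
    (hA : MonotoneOp.IsFirmlyNonexpansive A) (hB : MonotoneOp.IsMaximallyMonotone B) :
    MonotoneOp.NearlyEqual
      (MonotoneOp.ran (MonotoneOp.idOp - MonotoneOp.forwardBackward A B))
      (Set.range A + MonotoneOp.ran B) ∧
    (MonotoneOp.IsAffineRelation (MonotoneOp.ofFun A) → MonotoneOp.IsAffineRelation B →
      MonotoneOp.ran (MonotoneOp.idOp - MonotoneOp.forwardBackward A B) =
        closure (MonotoneOp.ran (MonotoneOp.idOp - MonotoneOp.forwardBackward A B)) ∧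
      closure (MonotoneOp.ran (MonotoneOp.idOp - MonotoneOp.forwardBackward A B)) =
        Set.range A + MonotoneOp.ran B) ∧
    (Function.Surjective A ∨ MonotoneOp.ran B = Set.univ →
      MonotoneOp.ran (MonotoneOp.idOp - MonotoneOp.forwardBackward A B) = Set.univ ∧
      MonotoneOp.fix (MonotoneOp.forwardBackward A B) = MonotoneOp.zerosOfSum A B ∧
      (MonotoneOp.zerosOfSum A B).Nonempty) := by
  have hsub := MonotoneOp.ran_id_sub_forwardBackward_subset A B
  have hri := MonotoneOp.intrinsicInterior_convexHull_subset_ran hA hB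
  have hle : ∀ S : AffineSubspace ℝ H, (S : Set H) = Set.range A + MonotoneOp.ran B →
      MonotoneOp.ran (MonotoneOp.idOp - MonotoneOp.forwardBackward A B) = Set.range A + MonotoneOp.ran B := by
    intro S hS
    refine hsub.antisymm ?_
    rwa [← hS, S.convex.convexHull_eq, intrinsicInterior_affineSubspace, hS] at hri
  refine ⟨MonotoneOp.nearlyEqual_of_intrinsicInterior_subset (convex_convexHull ℝ _) hri hsub
    (subset_convexHull ℝ _), fun hAa hBa => ?_, fun h => ?_⟩
  · obtain ⟨S, hS⟩ := hAa.exists_affineSubspace_ran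
    obtain ⟨T, hT⟩ := hBa.exists_affineSubspace_ran
    obtain ⟨U, hU⟩ := MonotoneOp.exists_affineSubspace_add S T
    rw [hS, hT, MonotoneOp.ran_ofFun] at hU
    rw [hle U hU, ← hU, (AffineSubspace.closed_of_finiteDimensional U).closure_eq]
    exact ⟨rfl, rfl⟩
  · have huniv : Set.range A + MonotoneOp.ran B = Set.univ := by
      obtain ⟨q, hq⟩ := hB.nonempty_gra
      rcases h with h | h
      · rw [h.range_eq]
        exact Set.univ_add ⟨q.2, q.1, hq⟩
      · rw [h]
        exact Set.add_univ (Set.range_nonempty A)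
    have hR : MonotoneOp.ran (MonotoneOp.idOp - MonotoneOp.forwardBackward A B) = Set.univ :=
      (hle ⊤ (by rw [huniv, AffineSubspace.top_coe])).trans huniv
    refine ⟨hR, MonotoneOp.fix_forwardBackward A B, ?_⟩
    obtain ⟨x, hx⟩ := MonotoneOp.mem_ran_id_sub_forwardBackward.1 (hR ▸ Set.mem_univ (0 : H))
    exact ⟨x, MonotoneOp.mem_zerosOfSum.2 (by simpa using hx)⟩
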